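/- Let $\mathcal H$ be a separable real Hilbert space and let $\{\mathcal P_t\}_{t\ge 0}$ be a Markov semigroup on $\mathcal H$, with transition probabilities $\mathcal P_t(u,\cdot)$ and $\mathcal P_t\phi(u)=\int\phi(v)\,\mathcal P_t(u,dv)$. Suppose that there are a non-decreasing sequence of positive times $(t_n)$, a sequence of positive reals $(\delta_n)$ converging to $0$, and a non-decreasing function $C:[0,\infty)\to\mathbb R$ such that, for every Fréchet differentiable $\phi:\mathcal H\to\mathbb R$ with $\|\phi\|_\infty=\sup|\phi|$ and $\|D\phi\|_\infty=\sup\|D\phi\|$ finite, every $n$ and every $u\in\mathcal H$, the function $\mathcal P_{t_n}\phi$ is Fréchet differentiable at $u$ and $$\|D\mathcal P_{t_n}\phi(u)\|\le C(\|u\|)\bigl(\|\phi\|_\infty+\delta_n\|D\phi\|_\infty\bigr).$$ Let $\mu_1\ne\mu_2$ be two ergodic invariant probability measures for $\{\mathcal P_t\}$; that is, each $\mu=\mu_i$ satisfies $\mathcal P_t^*\mu=\mu$ for all $t\ge 0$, and $\mu(A)\in\{0,1\}$ for every Borel set $A$ such that, for every $t\ge 0$, $\mathcal P_t(u,A)=\mathbf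 1_A(u)$ for $\mu$-almost every $u$. Then for all $u_1\in\operatorname{supp}\mu_1$ and $u_2\in\operatorname{supp}\mu_2$ one has $C(\|u_1\|\vee\|u_2\|)>0$ and $$\|u_1-u_2\|\ge\frac{1}{C(\|u_1\|\vee\|u_2\|)}.$$ Here $\operatorname{supp}\mu$ is the set of points $u$ all of whose open balls $\{v:\|u-v\|<r\}$, $r>0$, have positive $\mu$-measure. -/

import Mathlib

open MeasureTheory ProbabilityTheory Filter Topology
open scoped NNReal

/-- `P` is a Markov semigroup: a family of transition probabilities `P t u`, `t ≥ 0`, with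
`P 0 u = δ_u`, satisfying the Chapman-Kolmogorov equations. -/
structure IsMarkovSemigroup {X : Type*} [MeasurableSpace X] (P : ℝ≥0 → Kernel X X) : Prop where
  isMarkov : ∀ t, IsMarkovKernel (P t)
  zero : P 0 = Kernel.id
  add : ∀ s t, P (s + t) = P t ∘ₖ P s

/-- The action `(P_t φ)(u) = ∫ φ(v) P_t(u, dv)` of the semigroup on (bounded) functions. -/
noncomputable def semigroupAct {X : Type*} [MeasurableSpace X] (P : ℝ≥0 → Kernel X X)
    (t : ℝ≥0) (φ : X → ℝ) (u : X) : ℝ :=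
  ∫ v, φ v ∂(P t u)

/-- `μ` is an ergodic invariant probability measure of the semigroup: `P_t^* μ = μ` for all `t`,
and every measurable set `A` with, for all `t`, `P_t 1_A = 1_A` `μ`-almost everywhere has
`μ`-measure `0` or `1`. -/
structure IsErgodicInvariant {X : Type*} [MeasurableSpace X] (P : ℝ≥0 → Kernel X X)
    (μ : Measure X) : Prop where
  isProbability : IsProbabilityMeasure μ
  invariant : ∀ t, (P t).Invariant μ
  ergodic : ∀ A : Set X, MeasurableSet A →
    (∀ t, ∀ᵐ u ∂μ, P t u A = A.indicator 1 u) → μ A = 0 ∨ μ A = 1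

/-- The gradient bound with times `t n`, rates `δ n` and function `C`: for every Fréchet
differentiable `φ` with `‖φ‖_∞` and `‖Dφ‖_∞` finite, `P_{t n} φ` is Fréchet differentiable and
`‖D P_{t n} φ (u)‖ ≤ C(‖u‖) (‖φ‖_∞ + δ n ‖Dφ‖_∞)` for all `n` and `u`. -/
def GradientBound {H : Type*} [NormedAddCommGroup H] [InnerProductSpace ℝ H] [MeasurableSpace H]
    (P : ℝ≥0 → Kernel H H) (t : ℕ → ℝ≥0) (δ : ℕ → ℝ) (C : ℝ≥0 → ℝ) : Prop :=
  ∀ φ : H → ℝ, Differentiable ℝ φ →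
    BddAbove (Set.range fun v => ‖φ v‖) → BddAbove (Set.range fun v => ‖fderiv ℝ φ v‖) →
    ∀ (n : ℕ) (u : H), DifferentiableAt ℝ (semigroupAct P (t n) φ) u ∧
      ‖fderiv ℝ (semigroupAct P (t n) φ) u‖ ≤
        C ‖u‖₊ * ((⨆ v, ‖φ v‖) + δ n * ⨆ v, ‖fderiv ℝ φ v‖)

/-! Distinct ergodic invariant measures are mutually singular, so for each small `r` there are
disjoint compacts `K₁`, `K₂` carrying nearly all of `μ₁`, `μ₂`, and a `φ` with values in `[0,1]` and
bounded derivative, equal to 1 on `K₁` and 0 on `K₂`. By invariance, for each `n` the function `P_{t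
n} φ` is at least `1 - r` somewhere within `r` of `u₁` and at most `r` somewhere within `r` of `u₂`.
The gradient bound makes it Lipschitz on balls with constant `C R * (1 + δ n * L)`. As `φ` does not
depend on `n`, letting `n → ∞` removes `L`; then `r → 0` gives `1 ≤ C R * ‖u₁ - u₂‖`. -/

/-! ### Mutual singularity of ergodic measures -/

section Invariant

variable {X : Type*} [MeasurableSpace X]

theorem ProbabilityTheory.Kernel.Invariant.lintegral_apply {κ : Kernel X X} {μ : Measure X}
    (h : κ.Invariant μ) {s : Set X} (hs : MeasurableSet s) : ∫⁻ x, κ x s ∂μ = μ s := by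
  conv_rhs => rw [← h.def, Measure.bind_apply hs (Kernel.aemeasurable _)]

/-- The kernel is monotone on measures, so the image of the infimum lies below it; a Markov kernel
preserves total mass, which forces equality. -/
theorem ProbabilityTheory.Kernel.Invariant.inf {κ : Kernel X X} [IsMarkovKernel κ]
    {μ ν : Measure X} [IsFiniteMeasure μ] (hμ : κ.Invariant μ) (hν : κ.Invariant ν) :
    κ.Invariant (μ ⊓ ν) := by
  have hfin : IsFiniteMeasure (μ ⊓ ν) := isFiniteMeasure_of_le μ inf_le_left
  have hmono : ∀ {ρ : Measure X}, κ.Invariant ρ → μ ⊓ ν ≤ ρ → (μ ⊓ ν).bind κ ≤ ρ := by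
    intro ρ hρ hle
    refine Measure.le_iff.2 fun s hs => ?_
    rw [Measure.bind_apply hs (Kernel.aemeasurable _), ← hρ.lintegral_apply hs]
    exact lintegral_mono' hle le_rfl
  have hle : (μ ⊓ ν).bind κ ≤ μ ⊓ ν := le_inf (hmono hμ inf_le_left) (hmono hν inf_le_right)
  have : IsFiniteMeasure ((μ ⊓ ν).bind κ) := isFiniteMeasure_of_le _ hle
  refine Measure.eq_of_le_of_measure_univ_eq hle ?_
  rw [Measure.bind_apply .univ (Kernel.aemeasurable _)]
  simp

theorem ProbabilityTheory.Kernel.Invariant.sub {κ : Kernel X X} {μ ν : Measure X}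
    [IsFiniteMeasure μ] (hμ : κ.Invariant μ) (hν : κ.Invariant ν) (hle : ν ≤ μ) :
    κ.Invariant (μ - ν) := by
  have : IsFiniteMeasure ν := isFiniteMeasure_of_le μ hle
  have h : (μ - ν).bind κ + ν = μ := by
    have h2 := Measure.comp_add (μ := μ - ν) (ν := ν) (κ := κ)
    rw [Measure.sub_add_cancel_of_le hle, hμ.def, hν.def] at h2
    exact h2.symm
  have h' := Measure.add_sub_cancel (μ := (μ - ν).bind κ) (ν := ν)
  rw [h] at h'
  exact h'.symm

/-- A common part of the two remainders could be added to the infimum, so by finiteness it has mass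
zero. -/
theorem MeasureTheory.Measure.sub_inf_mutuallySingular {μ ν : Measure X} [IsFiniteMeasure μ] :
    (μ - μ ⊓ ν) ⟂ₘ (ν - μ ⊓ ν) := by
  have hfin : IsFiniteMeasure (μ ⊓ ν) := isFiniteMeasure_of_le μ inf_le_left
  refine Measure.mutuallySingular_of_disjoint (disjoint_iff.2 ?_)
  set τ := (μ - μ ⊓ ν) ⊓ (ν - μ ⊓ ν) with hτ
  have h1 : τ + μ ⊓ ν ≤ μ := by
    conv_rhs => rw [← Measure.sub_add_cancel_of_le (inf_le_left : μ ⊓ ν ≤ μ)]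
    gcongr
    exact inf_le_left
  have h2 : τ + μ ⊓ ν ≤ ν := by
    conv_rhs => rw [← Measure.sub_add_cancel_of_le (inf_le_right : μ ⊓ ν ≤ ν)]
    gcongr
    exact inf_le_right
  have h3 : τ Set.univ + (μ ⊓ ν) Set.univ ≤ (μ ⊓ ν) Set.univ := by
    simpa using (le_inf h1 h2) Set.univ
  have h4 : τ Set.univ ≤ 0 := by
    have : τ Set.univ + (μ ⊓ ν) Set.univ ≤ 0 + (μ ⊓ ν) Set.univ := by simpa using h3
    exact (ENNReal.add_le_add_iff_right (measure_ne_top _ _)).1 this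
  exact Measure.measure_univ_eq_zero.1 (le_antisymm h4 zero_le)

variable {P : ℝ≥0 → Kernel X X} {μ μ₁ μ₂ : Measure X}

/-- Let `A` be where the density of `ρ` is nonzero. Invariance of `ρ` prevents leaving `A`;
invariance of `μ` then leaves no mass to enter `A` from outside. Ergodicity applies to `A`. -/
theorem IsErgodicInvariant.eq_zero_or_absolutelyContinuous (hP : ∀ t, IsMarkovKernel (P t))
    (hμ : IsErgodicInvariant P μ) {ρ : Measure X} [IsFiniteMeasure ρ] (hρμ : ρ ≪ μ)
    (hρ : ∀ t, (P t).Invariant ρ) : ρ = 0 ∨ μ ≪ ρ := by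
  have := hμ.isProbability
  set f := ρ.rnDeriv μ with hf
  have hfm : Measurable f := Measure.measurable_rnDeriv _ _
  have hρf : μ.withDensity f = ρ := Measure.withDensity_rnDeriv_eq ρ μ hρμ
  set A : Set X := {x | f x ≠ 0} with hA
  have hAm : MeasurableSet A := (hfm (measurableSet_singleton 0)).compl
  have hnull : ∀ s : Set X, ρ s = 0 → μ (A ∩ s) = 0 := by
    intro s hs
    rw [← hρf] at hs
    exact (withDensity_apply_eq_zero hfm).1 hs
  have hρA : ρ Aᶜ = 0 := by
    rw [← hρf, withDensity_apply_eq_zero hfm]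
    simp [hA]
  have hin : ∀ t, ∀ᵐ x ∂μ, x ∈ A → P t x A = 1 := by
    intro t
    have h0 : ∫⁻ x, P t x Aᶜ ∂ρ = 0 := by rw [(hρ t).lintegral_apply hAm.compl, hρA]
    rw [lintegral_eq_zero_iff ((P t).measurable_coe hAm.compl), ← hρf] at h0
    have h1 := (ae_withDensity_iff hfm).1 h0
    filter_upwards [h1] with x hx hxA
    have := hP t
    exact (prob_compl_eq_zero_iff hAm).1 (hx hxA)
  have hout : ∀ t, ∀ᵐ x ∂μ, x ∈ Aᶜ → P t x A = 0 := by
    intro t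
    have h1 := (hμ.invariant t).lintegral_apply hAm
    have h2 : ∫⁻ x in A, P t x A ∂μ = μ A := by
      rw [setLIntegral_congr_fun_ae hAm (hin t)]
      simp
    rw [← lintegral_add_compl _ hAm, h2] at h1
    have h3 : ∫⁻ x in Aᶜ, P t x A ∂μ = 0 := by
      have : μ A + ∫⁻ x in Aᶜ, P t x A ∂μ = μ A + 0 := by simpa using h1
      exact (ENNReal.add_right_inj (measure_ne_top _ _)).1 this
    rw [lintegral_eq_zero_iff ((P t).measurable_coe hAm)] at h3
    exact (ae_restrict_iff' hAm.compl).1 h3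
  have hinv : ∀ t, ∀ᵐ u ∂μ, P t u A = A.indicator 1 u := by
    intro t
    filter_upwards [hin t, hout t] with x h1 h2
    by_cases hx : x ∈ A
    · simp [hx, h1 hx]
    · simp [hx, h2 hx]
  rcases hμ.ergodic A hAm hinv with h | h
  · left
    rw [← Measure.measure_univ_eq_zero, ← measure_add_measure_compl hAm, hρA, hρμ h, add_zero]
  · right
    refine Measure.AbsolutelyContinuous.mk fun s _ hs => ?_
    have hc : μ Aᶜ = 0 := (prob_compl_eq_zero_iff hAm).2 h
    refine measure_mono_null (t := (A ∩ s) ∪ Aᶜ) (fun x hx => ?_)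
      (measure_union_null (hnull s hs) hc)
    by_cases hxA : x ∈ A
    · exact Or.inl ⟨hxA, hx⟩
    · exact Or.inr hxA

theorem IsErgodicInvariant.mutuallySingular (hP : ∀ t, IsMarkovKernel (P t))
    (h₁ : IsErgodicInvariant P μ₁) (h₂ : IsErgodicInvariant P μ₂) (hne : μ₁ ≠ μ₂) :
    μ₁ ⟂ₘ μ₂ := by
  have := h₁.isProbability
  have := h₂.isProbability
  set π := μ₁ ⊓ μ₂ with hπ
  have hπ₁ : π ≤ μ₁ := inf_le_left
  have hπ₂ : π ≤ μ₂ := inf_le_right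
  have : IsFiniteMeasure π := isFiniteMeasure_of_le μ₁ hπ₁
  have hπi : ∀ t, (P t).Invariant π := fun t => by
    have := hP t
    exact (h₁.invariant t).inf (h₂.invariant t)
  have key : ∀ {μ : Measure X}, IsErgodicInvariant P μ → π ≤ μ → μ = π ∨ π ≪ μ - π := by
    intro μ hμ hle
    have := hμ.isProbability
    have : IsFiniteMeasure (μ - π) := isFiniteMeasure_of_le μ Measure.sub_le
    refine (hμ.eq_zero_or_absolutelyContinuous hP (ρ := μ - π)
      (Measure.absolutelyContinuous_of_le Measure.sub_le)
      fun t => (hμ.invariant t).sub (hπi t) hle).imp (fun h => ?_)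
      fun h => (Measure.absolutelyContinuous_of_le hle).trans h
    simpa [h] using (Measure.sub_add_cancel_of_le hle).symm
  rcases key h₁ hπ₁ with h | h
  · exact absurd (Measure.eq_of_le_of_isProbabilityMeasure (h.trans_le hπ₂)) hne
  rcases key h₂ hπ₂ with h' | h'
  · exact absurd (Measure.eq_of_le_of_isProbabilityMeasure (h'.trans_le hπ₁)).symm hne
  -- Here `π` is dominated by both remainders, which are mutually singular.
  have hself : π ⟂ₘ π := (Measure.sub_inf_mutuallySingular (μ := μ₁) (ν := μ₂)).mono_ac h h'
  exact Measure.mutuallySingular_of_disjoint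
    (disjoint_iff.2 ((Measure.MutuallySingular.self_iff π).1 hself))

end Invariant

/-! ### Smooth separation of a compact set from a closed set -/

section Separation

theorem Real.smoothTransition.exists_norm_deriv_le :
    ∃ M : ℝ, 0 ≤ M ∧ ∀ x, ‖deriv Real.smoothTransition x‖ ≤ M := by
  have hcont : Continuous (deriv Real.smoothTransition) :=
    (Real.smoothTransition.contDiff (n := 1)).continuous_deriv le_rfl
  obtain ⟨M, hM⟩ := (isCompact_Icc (a := (0 : ℝ)) (b := 1)).exists_bound_of_continuousOn
    hcont.continuousOn
  have hM0 : 0 ≤ M := (norm_nonneg _).trans (hM 0 (by simp))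
  refine ⟨M, hM0, fun x => ?_⟩
  by_cases hx : x ∈ Set.Icc (0 : ℝ) 1
  · exact hM x hx
  · have : deriv Real.smoothTransition x = 0 := by
      rw [Set.mem_Icc, not_and_or, not_le, not_le] at hx
      rcases hx with hx | hx
      · have : Real.smoothTransition =ᶠ[𝓝 x] fun _ => 0 := by
          filter_upwards [Iio_mem_nhds hx] with y hy
          exact Real.smoothTransition.zero_of_nonpos (le_of_lt hy)
        rw [this.deriv_eq, deriv_const]
      · have : Real.smoothTransition =ᶠ[𝓝 x] fun _ => 1 := by
          filter_upwards [Ioi_mem_nhds hx] with y hy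
          exact Real.smoothTransition.one_of_one_le (le_of_lt hy)
        rw [this.deriv_eq, deriv_const]
    simpa [this] using hM0

variable {E : Type*} [NormedAddCommGroup E]

theorem Real.smoothTransition.exists_norm_fderiv_comp_le [NormedSpace ℝ E] {f : E → ℝ}
    (hf : _root_.Differentiable ℝ f) {L : ℝ} {s : Set E} (hL : ∀ x ∈ s, ‖fderiv ℝ f x‖ ≤ L) :
    ∃ L', 0 ≤ L' ∧ ∀ x ∈ s, ‖fderiv ℝ (fun y => Real.smoothTransition (f y)) x‖ ≤ L' := by
  obtain ⟨M, hM0, hM⟩ := Real.smoothTransition.exists_norm_deriv_le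
  -- `L` may be negative when `s` is empty, hence `|L|`.
  refine ⟨M * |L|, by positivity, fun x hx => ?_⟩
  have hd : DifferentiableAt ℝ Real.smoothTransition (f x) :=
    (Real.smoothTransition.contDiff (n := 1)).differentiable one_ne_zero _
  have : HasFDerivAt (fun y => Real.smoothTransition (f y))
      (_root_.deriv Real.smoothTransition (f x) • fderiv ℝ f x) x :=
    hd.hasDerivAt.comp_hasFDerivAt x (hf x).hasFDerivAt
  rw [this.fderiv, norm_smul]
  exact mul_le_mul (hM _) ((hL x hx).trans (le_abs_self L)) (norm_nonneg _) hM0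

variable [InnerProductSpace ℝ E]

theorem exists_smooth_bump (c : E) {r : ℝ} (hr : 0 < r) :
    ∃ f : E → ℝ, Differentiable ℝ f ∧ (∃ L, ∀ x, ‖fderiv ℝ f x‖ ≤ L) ∧ (∀ x, 0 ≤ f x) ∧
      (∀ x, ‖x - c‖ ≤ r → 1 ≤ f x) ∧ ∀ x, 2 * r ≤ ‖x - c‖ → f x = 0 := by
  set g : E → ℝ := fun x => 2 - ‖x - c‖ ^ 2 / r ^ 2 with hg
  have hgder : ∀ x, HasFDerivAt g (-((r ^ 2)⁻¹ • (2 • innerSL ℝ (x - c)))) x := by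
    intro x
    have h1 : HasFDerivAt (fun y : E => ‖y - c‖ ^ 2) (2 • innerSL ℝ (x - c)) x := by
      simpa using ((hasFDerivAt_id x).sub_const c).norm_sq
    have h2 := (h1.const_smul (r ^ 2)⁻¹).const_sub 2
    refine h2.congr_of_eventuallyEq (Eventually.of_forall fun y => ?_)
    simp [hg, div_eq_inv_mul]
  have hgd : Differentiable ℝ g := fun x => (hgder x).differentiableAt
  -- The derivative of `g` is unbounded, so it is controlled only up to radius `3 / 2 * r`; since
  -- `(3 / 2) ^ 2 > 2`, the bump vanishes beyond.
  have hzero : ∀ x, 3 / 2 * r < ‖x - c‖ → Real.smoothTransition (g x) = 0 := by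
    intro x hx
    refine Real.smoothTransition.zero_of_nonpos ?_
    have : 2 * r ^ 2 ≤ ‖x - c‖ ^ 2 := by nlinarith
    have : 2 ≤ ‖x - c‖ ^ 2 / r ^ 2 := (le_div_iff₀ (by positivity)).2 this
    simp only [hg]
    linarith
  obtain ⟨L, hL0, hL⟩ := Real.smoothTransition.exists_norm_fderiv_comp_le hgd
    (L := (r ^ 2)⁻¹ * (2 * (3 / 2 * r))) (s := {x | ‖x - c‖ ≤ 3 / 2 * r}) (by
      intro x hx
      rw [(hgder x).fderiv, norm_neg, norm_smul, Real.norm_of_nonneg (by positivity)]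
      refine mul_le_mul_of_nonneg_left ?_ (by positivity)
      refine (norm_nsmul_le).trans ?_
      rw [innerSL_apply_norm]
      have : ‖x - c‖ ≤ 3 / 2 * r := hx
      push_cast
      linarith)
  refine ⟨fun x => Real.smoothTransition (g x), ?_, ⟨L, fun x => ?_⟩,
    fun x => Real.smoothTransition.nonneg _, fun x hx => ?_, fun x hx => hzero x (by linarith)⟩
  · exact ((Real.smoothTransition.contDiff (n := 1)).differentiable one_ne_zero).comp hgd
  · by_cases hx : ‖x - c‖ ≤ 3 / 2 * r
    · exact hL x hx
    · have hev : (fun y => Real.smoothTransition (g y)) =ᶠ[𝓝 x] fun _ => 0 := by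
        have hopen : IsOpen {y : E | 3 / 2 * r < ‖y - c‖} :=
          isOpen_lt continuous_const (by fun_prop)
        filter_upwards [hopen.mem_nhds (not_le.1 hx)] with y hy
        exact hzero y hy
      rw [hev.fderiv_eq]
      simpa using hL0
  · refine (Real.smoothTransition.one_of_one_le ?_).ge
    have : ‖x - c‖ ^ 2 / r ^ 2 ≤ 1 := by
      refine (div_le_one (by positivity)).2 ?_
      gcongr
    simp only [hg]
    linarith

/-- Compactness keeps the sum of bumps finite, hence its gradient bounded; the smooth transition
then caps it at 1. -/
theorem IsCompact.exists_differentiable_separating {K F : Set E} (hK : IsCompact K)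
    (hF : IsClosed F) (hKF : Disjoint K F) :
    ∃ φ : E → ℝ, Differentiable ℝ φ ∧ (∃ L, ∀ x, ‖fderiv ℝ φ x‖ ≤ L) ∧
      (∀ x, 0 ≤ φ x) ∧ (∀ x, φ x ≤ 1) ∧ (∀ x ∈ K, φ x = 1) ∧ ∀ x ∈ F, φ x = 0 := by
  obtain ⟨d, hd, hdist⟩ := hKF.exists_thickenings hK hF
  have hsep : ∀ x ∈ K, ∀ y ∈ F, d ≤ ‖y - x‖ := by
    intro x hx y hy
    by_contra! h
    refine Set.disjoint_left.1 hdist ?_ (Metric.self_subset_thickening hd _ hy)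
    exact Metric.mem_thickening_iff.2 ⟨x, hx, by rwa [dist_eq_norm]⟩
  have hr : 0 < d / 2 := by positivity
  choose f hfd hfL hf0 hf1 hfz using fun c : E => exists_smooth_bump c hr
  choose L hL using hfL
  obtain ⟨s, hsK, hscov⟩ := hK.elim_nhds_subcover (fun x => Metric.ball x (d / 2))
    fun x _ => Metric.ball_mem_nhds x hr
  set g : E → ℝ := fun x => ∑ c ∈ s, f c x with hg
  have hgd : Differentiable ℝ g := Differentiable.fun_sum fun c _ => hfd c
  have hgL : ∀ x, ‖fderiv ℝ g x‖ ≤ ∑ c ∈ s, L c := by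
    intro x
    rw [hg, fderiv_fun_sum fun c _ => hfd c x]
    exact (norm_sum_le _ _).trans (Finset.sum_le_sum fun c _ => hL c x)
  obtain ⟨L', -, hL'⟩ := Real.smoothTransition.exists_norm_fderiv_comp_le hgd (s := Set.univ)
    fun x _ => hgL x
  refine ⟨fun x => Real.smoothTransition (g x), ?_, ⟨L', fun x => hL' x trivial⟩,
    fun x => Real.smoothTransition.nonneg _, fun x => Real.smoothTransition.le_one _,
    fun x hx => Real.smoothTransition.one_of_one_le ?_,
    fun x hx => Real.smoothTransition.zero_of_nonpos (Finset.sum_nonpos fun c hc => ?_)⟩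
  · exact ((Real.smoothTransition.contDiff (n := 1)).differentiable one_ne_zero).comp hgd
  · obtain ⟨c, hc, hxc⟩ := Set.mem_iUnion₂.1 (hscov hx)
    refine (hf1 c x ?_).trans (Finset.single_le_sum (f := fun c => f c x) (fun c _ => hf0 c x) hc)
    rw [← dist_eq_norm]
    exact (Metric.mem_ball.1 hxc).le
  · refine (hfz c x ?_).le
    have := hsep c (hsK c hc) x hx
    linarith

end Separation

/-! ### Measure estimates -/

theorem ProbabilityTheory.Kernel.Invariant.exists_mem_apply_lt {X : Type*} [MeasurableSpace X]
    {κ : Kernel X X} {μ : Measure X} (h : κ.Invariant μ) {B S : Set X} (hB : MeasurableSet B)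
    (hS : MeasurableSet S) {ε : ENNReal} (hlt : μ S < ε * μ B) : ∃ y ∈ B, κ y S < ε := by
  by_contra! hcon
  refine hlt.not_ge ?_
  calc ε * μ B = ∫⁻ _ in B, ε ∂μ := by simp
    _ ≤ ∫⁻ y in B, κ y S ∂μ := setLIntegral_mono' hB hcon
    _ ≤ ∫⁻ y, κ y S ∂μ := setLIntegral_le_lintegral _ _
    _ = μ S := h.lintegral_apply hS

theorem MeasureTheory.Measure.MutuallySingular.exists_isCompact_disjoint {X : Type*}
    [TopologicalSpace X] [MeasurableSpace X] [BorelSpace X] [T2Space X] {μ ν : Measure X} [IsFiniteMeasure μ]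
    [IsFiniteMeasure ν] [μ.InnerRegularCompactLTTop] [ν.InnerRegularCompactLTTop]
    (h : μ ⟂ₘ ν) {ε : ENNReal} (hε : ε ≠ 0) :
    ∃ K L : Set X, IsCompact K ∧ IsCompact L ∧ Disjoint K L ∧ μ Kᶜ < ε ∧ ν Lᶜ < ε := by
  obtain ⟨s, hs, hμs, hνs⟩ := h
  obtain ⟨K, hKs, hK, hKlt⟩ := hs.compl.exists_isCompact_sdiff_lt (measure_ne_top μ _) hε
  obtain ⟨L, hLs, hL, hLlt⟩ := hs.exists_isCompact_sdiff_lt (measure_ne_top ν _) hε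
  refine ⟨K, L, hK, hL, (disjoint_compl_left (a := s)).mono hKs hLs, ?_, ?_⟩
  · refine (measure_mono fun x hx => ?_).trans_lt
      ((measure_union_le s (sᶜ \ K)).trans_lt (by rwa [hμs, zero_add]))
    by_cases hxs : x ∈ s
    · exact Or.inl hxs
    · exact Or.inr ⟨hxs, hx⟩
  · refine (measure_mono fun x hx => ?_).trans_lt
      ((measure_union_le sᶜ (s \ L)).trans_lt (by rwa [hνs, zero_add]))
    by_cases hxs : x ∈ s
    · exact Or.inr ⟨hxs, hx⟩
    · exact Or.inl hxs

theorem one_sub_le_integral_of_eq_one_on {X : Type*} [MeasurableSpace X] {ρ : Measure X}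
    [IsProbabilityMeasure ρ] {φ : X → ℝ} (hφ : Integrable φ ρ) (h0 : ∀ x, 0 ≤ φ x) {K : Set X}
    (hK : MeasurableSet K) (hφK : ∀ x ∈ K, φ x = 1) : 1 - ρ.real Kᶜ ≤ ∫ x, φ x ∂ρ := by
  rw [probReal_compl_eq_one_sub hK, sub_sub_cancel, ← integral_indicator_one hK]
  refine integral_mono ((integrable_const (1 : ℝ)).indicator hK) hφ fun x => ?_
  by_cases hx : x ∈ K
  · simp [hx, hφK x hx]
  · simpa [hx] using h0 x

/-! ### Lipschitz consequences of the gradient bound -/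

section GradientBound

variable {H : Type*} [NormedAddCommGroup H] [InnerProductSpace ℝ H] [MeasurableSpace H]
  {P : ℝ≥0 → Kernel H H} {t : ℕ → ℝ≥0} {δ : ℕ → ℝ} {C : ℝ≥0 → ℝ}

theorem GradientBound.nonneg (h : GradientBound P t δ C) (u : H) : 0 ≤ C ‖u‖₊ := by
  have := (h (fun _ => 1) (differentiable_const _) ⟨1, by rintro _ ⟨v, rfl⟩; simp⟩
    ⟨0, by rintro _ ⟨v, rfl⟩; simp⟩ 0 u).2
  simpa using (norm_nonneg _).trans this

theorem GradientBound.abs_semigroupAct_sub_le (h : GradientBound P t δ C) (hδ : ∀ n, 0 < δ n)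
    (hC : Monotone C) {φ : H → ℝ} (hφ : Differentiable ℝ φ) (h0 : ∀ x, 0 ≤ φ x)
    (h1 : ∀ x, φ x ≤ 1) {L : ℝ} (hL : ∀ x, ‖fderiv ℝ φ x‖ ≤ L) {R : ℝ≥0} (n : ℕ) {u v : H}
    (hu : ‖u‖₊ ≤ R) (hv : ‖v‖₊ ≤ R) :
    |semigroupAct P (t n) φ u - semigroupAct P (t n) φ v| ≤ C R * (1 + δ n * L) * ‖u - v‖ := by
  have hn1 : ∀ x, ‖φ x‖ ≤ 1 := fun x => by
    rw [Real.norm_of_nonneg (h0 x)]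
    exact h1 x
  have key := h φ hφ ⟨1, by rintro _ ⟨x, rfl⟩; exact hn1 x⟩ ⟨L, by rintro _ ⟨x, rfl⟩; exact hL x⟩ n
  have hmem : ∀ {w : H}, ‖w‖₊ ≤ R → w ∈ Metric.closedBall (0 : H) R := fun hw => by
    simpa [← NNReal.coe_le_coe] using hw
  rw [← Real.norm_eq_abs]
  refine (convex_closedBall (0 : H) (R : ℝ)).norm_image_sub_le_of_norm_fderiv_le (𝕜 := ℝ)
    (fun x _ => (key x).1) (fun x hx => (key x).2.trans ?_) (hmem hv) (hmem hu)
  have hx' : ‖x‖₊ ≤ R := by simpa [← NNReal.coe_le_coe] using hx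
  have hδn := hδ n
  have hsup0 : 0 ≤ ⨆ x, ‖φ x‖ := Real.iSup_nonneg fun _ => norm_nonneg _
  have hsup0' : 0 ≤ ⨆ x, ‖fderiv ℝ φ x‖ := Real.iSup_nonneg fun _ => norm_nonneg _
  refine mul_le_mul (hC hx') (add_le_add (ciSup_le hn1) ?_) (by positivity)
    ((h.nonneg x).trans (hC hx'))
  exact mul_le_mul_of_nonneg_left (ciSup_le hL) hδn.le

end GradientBound

/-! ### The quantitative estimate and its limit -/

section Main

variable {H : Type*} [NormedAddCommGroup H] [InnerProductSpace ℝ H] [CompleteSpace H]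
    [TopologicalSpace.SeparableSpace H] [MeasurableSpace H] [BorelSpace H]
    {P : ℝ≥0 → Kernel H H} {t : ℕ → ℝ≥0} {δ : ℕ → ℝ} {C : ℝ≥0 → ℝ}

/-- Moving from each `uᵢ` to a nearby good point costs an error of order `r`, with constant `C (R +
1)` because `r ≤ 1`; only the step from `u₁` to `u₂` needs the sharp `C R`. -/
theorem GradientBound.one_sub_le (h : GradientBound P t δ C) (hδ : ∀ n, 0 < δ n)
    (hδ_lim : Tendsto δ atTop (𝓝 0)) (hC : Monotone C) (hP : ∀ t, IsMarkovKernel (P t))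
    {μ₁ μ₂ : Measure H} [IsFiniteMeasure μ₁] [IsFiniteMeasure μ₂]
    (hi₁ : ∀ t, (P t).Invariant μ₁) (hi₂ : ∀ t, (P t).Invariant μ₂) (hsing : μ₁ ⟂ₘ μ₂)
    {u₁ u₂ : H} (hu₁ : u₁ ∈ μ₁.support) (hu₂ : u₂ ∈ μ₂.support) {R : ℝ≥0}
    (hR₁ : ‖u₁‖₊ ≤ R) (hR₂ : ‖u₂‖₊ ≤ R) {r : ℝ} (hr : 0 < r) (hr1 : r ≤ 1) :
    1 - 2 * r ≤ C R * ‖u₁ - u₂‖ + 2 * (C (R + 1) * r) := by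
  have hsec : SecondCountableTopology H := UniformSpace.secondCountable_of_separable H
  have hm₁ : 0 < μ₁ (Metric.ball u₁ r) :=
    (Measure.mem_support_iff_forall u₁).1 hu₁ _ (Metric.ball_mem_nhds u₁ hr)
  have hm₂ : 0 < μ₂ (Metric.ball u₂ r) :=
    (Measure.mem_support_iff_forall u₂).1 hu₂ _ (Metric.ball_mem_nhds u₂ hr)
  have hr' : ENNReal.ofReal r ≠ 0 := by simpa using hr
  -- This tolerance is what averaging over the balls needs to find a point with escape probability
  -- below `r`.
  obtain ⟨K₁, K₂, hK₁, hK₂, hK, hK₁lt, hK₂lt⟩ := hsing.exists_isCompact_disjoint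
    (ε := min (ENNReal.ofReal r * μ₁ (Metric.ball u₁ r)) (ENNReal.ofReal r * μ₂ (Metric.ball u₂ r)))
    (by
      rw [← pos_iff_ne_zero, lt_min_iff]
      exact ⟨ENNReal.mul_pos hr' hm₁.ne', ENNReal.mul_pos hr' hm₂.ne'⟩)
  obtain ⟨φ, hφ, ⟨L, hL⟩, h0, h1, hφ₁, hφ₂⟩ :=
    hK₁.exists_differentiable_separating hK₂.isClosed hK
  have hbound : ∀ n, 1 - 2 * r ≤
      C R * (1 + δ n * L) * ‖u₁ - u₂‖ + 2 * (C (R + 1) * (1 + δ n * L) * r) := by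
    intro n
    have := hP (t n)
    have hint : ∀ y, Integrable φ (P (t n) y) := fun y =>
      Integrable.of_bound hφ.continuous.aestronglyMeasurable 1 (ae_of_all _ fun x => by
        rw [Real.norm_of_nonneg (h0 x)]
        exact h1 x)
    obtain ⟨y₁, hy₁, hPy₁⟩ := (hi₁ (t n)).exists_mem_apply_lt Metric.isOpen_ball.measurableSet
      hK₁.measurableSet.compl (hK₁lt.trans_le (min_le_left _ _))
    obtain ⟨y₂, hy₂, hPy₂⟩ := (hi₂ (t n)).exists_mem_apply_lt Metric.isOpen_ball.measurableSet
      hK₂.measurableSet.compl (hK₂lt.trans_le (min_le_right _ _))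
    have hreal : ∀ {a : ENNReal}, a < ENNReal.ofReal r → a.toReal ≤ r := fun ha =>
      ENNReal.toReal_le_of_le_ofReal hr.le ha.le
    have hv₁ : 1 - r ≤ semigroupAct P (t n) φ y₁ :=
      (sub_le_sub_left (hreal hPy₁) 1).trans
        (one_sub_le_integral_of_eq_one_on (hint y₁) h0 hK₁.measurableSet hφ₁)
    have hv₂ : semigroupAct P (t n) φ y₂ ≤ r := by
      have h2 := one_sub_le_integral_of_eq_one_on (ρ := P (t n) y₂) (φ := fun x => 1 - φ x)
        ((integrable_const 1).sub (hint y₂)) (fun x => sub_nonneg.2 (h1 x)) hK₂.measurableSet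
        (fun x hx => by simp [hφ₂ x hx])
      rw [integral_sub (integrable_const 1) (hint y₂)] at h2
      have h3 : (P (t n) y₂).real K₂ᶜ ≤ r := hreal hPy₂
      simp only [integral_const, probReal_univ, smul_eq_mul, mul_one] at h2
      rw [semigroupAct]
      linarith
    have hnear : ∀ {u y : H}, ‖u‖₊ ≤ R → y ∈ Metric.ball u r →
        |semigroupAct P (t n) φ y - semigroupAct P (t n) φ u| ≤
          C (R + 1) * (1 + δ n * L) * r := by
      intro u y hu hy
      have hyu : ‖y - u‖ ≤ r := by
        rw [← dist_eq_norm]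
        exact (Metric.mem_ball.1 hy).le
      have hyR : ‖y‖₊ ≤ R + 1 := by
        rw [← NNReal.coe_le_coe] at hu ⊢
        have := norm_le_norm_add_norm_sub' y u
        simp only [NNReal.coe_add, coe_nnnorm, NNReal.coe_one] at hu ⊢
        linarith
      have hL0 : 0 ≤ L := (norm_nonneg _).trans (hL 0)
      have hC0 : 0 ≤ C (R + 1) := (h.nonneg y).trans (hC hyR)
      have hδn := hδ n
      refine (h.abs_semigroupAct_sub_le hδ hC hφ h0 h1 hL n hyR
        (hu.trans le_self_add)).trans ?_
      gcongr
    have e₁ := (abs_le.1 (hnear hR₁ hy₁)).2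
    have e₂ := (abs_le.1 (hnear hR₂ hy₂)).1
    have e := (abs_le.1 (h.abs_semigroupAct_sub_le hδ hC hφ h0 h1 hL n hR₁ hR₂)).2
    linarith
  have hlim : Tendsto (fun n => C R * (1 + δ n * L) * ‖u₁ - u₂‖ +
      2 * (C (R + 1) * (1 + δ n * L) * r)) atTop
      (𝓝 (C R * (1 + 0 * L) * ‖u₁ - u₂‖ + 2 * (C (R + 1) * (1 + 0 * L) * r))) := by
    have h1 : Tendsto (fun n => 1 + δ n * L) atTop (𝓝 (1 + 0 * L)) :=
      (hδ_lim.mul_const L).const_add 1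
    exact ((h1.const_mul _).mul_const _).add (((h1.const_mul _).mul_const r).const_mul 2)
  simpa using ge_of_tendsto' hlim hbound

end Main

theorem mainTheorem8 {H : Type*} [NormedAddCommGroup H] [InnerProductSpace ℝ H] [CompleteSpace H]
    [TopologicalSpace.SeparableSpace H] [MeasurableSpace H] [BorelSpace H]
    (P : ℝ≥0 → Kernel H H) (hP : IsMarkovSemigroup P)
    (t : ℕ → ℝ≥0) (ht_pos : ∀ n, 0 < t n) (ht_mono : Monotone t)
    (δ : ℕ → ℝ) (hδ_pos : ∀ n, 0 < δ n) (hδ_lim : Tendsto δ atTop (𝓝 0))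
    (C : ℝ≥0 → ℝ) (hC : Monotone C)
    (hSF : GradientBound P t δ C)
    (μ₁ μ₂ : Measure H) (hμ₁ : IsErgodicInvariant P μ₁) (hμ₂ : IsErgodicInvariant P μ₂)
    (hne : μ₁ ≠ μ₂)
    (u₁ u₂ : H) (hu₁ : u₁ ∈ μ₁.support) (hu₂ : u₂ ∈ μ₂.support) :
    0 < C (‖u₁‖₊ ⊔ ‖u₂‖₊) ∧ ‖u₁ - u₂‖ ≥ 1 / C (‖u₁‖₊ ⊔ ‖u₂‖₊) := by
  have := hμ₁.isProbability
  have := hμ₂.isProbability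
  set R := ‖u₁‖₊ ⊔ ‖u₂‖₊ with hR
  have hbound : ∀ᶠ r in 𝓝[>] (0 : ℝ),
      1 - 2 * r ≤ C R * ‖u₁ - u₂‖ + 2 * (C (R + 1) * r) := by
    filter_upwards [Ioc_mem_nhdsGT one_pos] with r hr
    exact hSF.one_sub_le hδ_pos hδ_lim hC hP.isMarkov hμ₁.invariant hμ₂.invariant
      (hμ₁.mutuallySingular hP.isMarkov hμ₂ hne) hu₁ hu₂ le_sup_left le_sup_right hr.1 hr.2
  have hlim₁ : Tendsto (fun r : ℝ => 1 - 2 * r) (𝓝[>] 0) (𝓝 (1 - 2 * 0)) :=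
    ((continuous_const.sub (continuous_const.mul continuous_id)).tendsto 0).mono_left
      nhdsWithin_le_nhds
  have hlim₂ : Tendsto (fun r : ℝ => C R * ‖u₁ - u₂‖ + 2 * (C (R + 1) * r)) (𝓝[>] 0)
      (𝓝 (C R * ‖u₁ - u₂‖ + 2 * (C (R + 1) * 0))) := by
    have : Continuous fun r : ℝ => C R * ‖u₁ - u₂‖ + 2 * (C (R + 1) * r) := by fun_prop
    exact (this.tendsto 0).mono_left nhdsWithin_le_nhds
  have hone : 1 ≤ C R * ‖u₁ - u₂‖ := by
    simpa using le_of_tendsto_of_tendsto hlim₁ hlim₂ hbound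
  have hpos : 0 < C R := by
    by_contra! hcon
    have := mul_nonpos_of_nonpos_of_nonneg hcon (norm_nonneg (u₁ - u₂))
    linarith
  exact ⟨hpos, (div_le_iff₀' hpos).2 hone⟩
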